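/- **Corollary 5.6.** Let $X,Y$ be finite-dimensional real normed spaces with $\dim Y<\dim X$, and let $T$ be a compact metric space. Let $f:X\to(-\infty,\infty]$, $g_t:X\to\mathbb R$ ($t\in T$) and $h:X\to Y$. Consider the problem of minimizing $f(x)$ over the feasible set $$\Omega=\{x\in X : h(x)=0,\ g_t(x)\le 0\ \text{for all } t\in T\}.$$ Assume that every $g_t$ is Fréchet differentiable on $X$ and that $(x,t)\mapsto g_t(x)$ and $(x,t)\mapsto\nabla g_t(x)\in X^*$ are continuous on $X\times T$. Let $\bar x\in\Omega$ with $f(\bar x)<\infty$ be a local minimizer of the problem, that is, $f(x)\ge f(\bar x)$ for all $x\in\Omega$ near $\bar x$. Let $h$ be strictly differentiable at $\bar x$, and let $f$ be lower semicontinuous at every point of some neighborhood of $\bar x$. Notation: $T(\bar x)=\{t\in T: g_t(\bar x)=0\}$ is the set of active indices; $\operatorname{cone} S$ is the convex cone generated by $S\cup\{0\}$; and $\nabla h(\bar x)^*:Y^*\to X^*$ is the adjoint of $\nabla h(\bar x)$. For $\varepsilon\ge 0$ put $$\widehat\partial_\varepsilon f(x)=\Big\{x^*\in X^* : \liminf_{u\to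 x,\,u\ne x}\frac{f(u)-f(x)-\langle x^*,u-x\rangle}{\|u-x\|}\ge-\varepsilon\Big\}$$ if $f(x)<\infty$, and $\widehat\partial_\varepsilon f(x)=\emptyset$ otherwise. The limiting subdifferential $\partial f(\bar x)$ is the set of all weak$^*$ limits $x^*=\lim_n x_n^*$ with $x_n^*\in\widehat\partial_{\varepsilon_n}f(x_n)$ for some sequences $x_n\to\bar x$ with $f(x_n)\to f(\bar x)$ and $\varepsilon_n\downarrow0$. The singular subdifferential $\partial^\infty f(\bar x)$ is the set of all weak$^*$ limits $x^*=\lim_n c_nx_n^*$ with $x_n$, $\varepsilon_n$, $x_n^*$ as before and $c_n\downarrow0$, $c_n>0$. Suppose that the qualification condition $$\partial^\infty f(\bar x)\cap\Big[-\operatorname{cone}\{\nabla g_t(\bar x): t\in T(\bar x)\}-\nabla h(\bar x)^*(Y^*)\Big]=\{0\}$$ holds, and that the Extended Mangasarian–Fromovitz Constraint Qualification holds at $\bar x$: the derivative $\nabla h(\bar x):X\to Y$ is surjective and there is $\tilde x\in X$ with $\nabla h(\bar x)\tilde x=0$ and $\langle\nabla g_t(\bar x),\tilde x\rangle<0$ for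 all $t\in T(\bar x)$. Then there exist $\lambda=(\lambda_t)_{t\in T}$ with $\lambda_t\ge0$ for all $t$, $\lambda_t\ne 0$ for only finitely many $t$, and $\lambda_t=0$ for $t\notin T(\bar x)$, and there exists $y^*\in Y^*$, such that $$0\in\partial f(\bar x)+\sum_{t\in T(\bar x)}\lambda_t\nabla g_t(\bar x)+\nabla h(\bar x)^*y^*.$$ -/

import Mathlib

open Filter Topology
open scoped Pointwise

namespace SemiInfinite

section Subdifferentials

variable {X : Type*} [NormedAddCommGroup X] [NormedSpace ℝ X]

/-- The analytic `ε`-subdifferential of `φ : X → (-∞, ∞]` at `x`: it is empty if `φ x = ∞`, and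
otherwise consists of the `x' ∈ X*` with
`liminf_{u → x, u ≠ x} (φ u - φ x - ⟨x', u - x⟩) / ‖u - x‖ ≥ -ε`. -/
def epsSubdifferential (ε : ℝ) (φ : X → EReal) (x : X) : Set (StrongDual ℝ X) :=
  {x' | φ x ≠ ⊤ ∧
    ((-ε : ℝ) : EReal) ≤
      liminf (fun u : X => (φ u - φ x - ((x' (u - x) : ℝ) : EReal)) / ((‖u - x‖ : ℝ) : EReal))
        (𝓝[≠] x)}

/-- The limiting (basic, Mordukhovich) subdifferential of `φ` at a point `x` of its domain: the
sequential outer limit, in the weak* topology of `X*`, of the `ε`-subdifferentials at `u` as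
`u → x`, `φ u → φ x`, `ε ↓ 0`. -/
def limitingSubdifferential (φ : X → EReal) (x : X) : Set (StrongDual ℝ X) :=
  {x' | ∃ (u : ℕ → X) (ε : ℕ → ℝ) (u' : ℕ → StrongDual ℝ X),
    Tendsto u atTop (𝓝 x) ∧ Tendsto (fun n => φ (u n)) atTop (𝓝 (φ x)) ∧
    (∀ n, 0 < ε n) ∧ Tendsto ε atTop (𝓝 0) ∧
    (∀ n, u' n ∈ epsSubdifferential (ε n) φ (u n)) ∧
    ∀ v : X, Tendsto (fun n => u' n v) atTop (𝓝 (x' v))}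

/-- The singular (horizontal) subdifferential of `φ` at a point `x` of its domain: the sequential
outer limit, in the weak* topology of `X*`, of `c • ∂̂_ε φ(u)` as `u → x`, `φ u → φ x`,
`c ↓ 0`, `ε ↓ 0`. -/
def singularSubdifferential (φ : X → EReal) (x : X) : Set (StrongDual ℝ X) :=
  {x' | ∃ (u : ℕ → X) (c ε : ℕ → ℝ) (u' : ℕ → StrongDual ℝ X),
    Tendsto u atTop (𝓝 x) ∧ Tendsto (fun n => φ (u n)) atTop (𝓝 (φ x)) ∧
    (∀ n, 0 < c n) ∧ Tendsto c atTop (𝓝 0) ∧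
    (∀ n, 0 < ε n) ∧ Tendsto ε atTop (𝓝 0) ∧
    (∀ n, u' n ∈ epsSubdifferential (ε n) φ (u n)) ∧
    ∀ v : X, Tendsto (fun n => c n * u' n v) atTop (𝓝 (x' v))}

end Subdifferentials

section Constraints

variable {X Y T : Type*} [NormedAddCommGroup X] [NormedSpace ℝ X]
  [NormedAddCommGroup Y] [NormedSpace ℝ Y]

/-- The feasible set `{x | h x = 0, g_t x ≤ 0 for all t ∈ T}`. -/
def feasibleSet (g : T → X → ℝ) (h : X → Y) : Set X :=
  {x | h x = 0 ∧ ∀ t, g t x ≤ 0}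

/-- The set `T(x)` of active indices at `x`. -/
def activeIndices (g : T → X → ℝ) (x : X) : Set T :=
  {t | g t x = 0}

/-- The Extended Mangasarian-Fromovitz Constraint Qualification at `x`. -/
def EMFCQ (g : T → X → ℝ) (h : X → Y) (x : X) : Prop :=
  Function.Surjective (fderiv ℝ h x) ∧
    ∃ d : X, fderiv ℝ h x d = 0 ∧ ∀ t ∈ activeIndices g x, fderiv ℝ (g t) x d < 0

/-- `cone {∇g_t(x) | t ∈ T(x)}`: the convex cone generated by the active gradients together
with `0` (so it is `{0}` if no index is active). -/
def activeGradientCone (g : T → X → ℝ) (x : X) : Set (StrongDual ℝ X) :=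
  (PointedCone.hull ℝ ((fun t => fderiv ℝ (g t) x) '' activeIndices g x) :
    PointedCone ℝ (StrongDual ℝ X))

/-- `∇h(x)*(Y*)`: the range of the adjoint of the derivative of `h` at `x`. -/
def adjointRange (h : X → Y) (x : X) : Set (StrongDual ℝ X) :=
  Set.range fun y' : StrongDual ℝ Y => y'.comp (fderiv ℝ h x)

end Constraints

end SemiInfinite

/-!
Multiplier rule for a semi-infinite program with a lower semicontinuous objective.

The constraint is decoupled from the objective by minimizing
`f u + (k + 1) * |u - x|² + |u - x̄|²` over `u` near `x̄` and feasible `x` near `x̄`, with `|·|` an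
auxiliary Euclidean norm (`exists_subgradient_proximalNormal_sequences`). The minimizers converge
to `x̄`, and the derivative `p k` of the coupling term is at the same time, up to sign and a small
error, a subgradient of `f` at `u k`, and a proximal normal to the feasible set at `x k`.

Every limit `P` of rescaled `p k` is a normal of the required form. Indeed, if `∇h(x̄) w = 0` and
`⟨∇g_t(x̄), w⟩ < 0` for all active `t`, then `w` lies in the Clarke tangent cone of the feasible
set (`exists_near_direction_mem_feasibleSet`): strict differentiability and surjectivity of
`∇h(x̄)` correct a step along `w` to one with `h = 0`, uniformly near `x̄`, and compactness of the
index set gives one step size for all inequalities. Proximal normals are asymptotically nonpositive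
on such directions (`limit_proximalNormal_apply_nonpos`), so a Farkas lemma, in which the
constraint qualification supplies the Slater point, places `P` in
`cone {∇g_t(x̄)} + ∇h(x̄)* Y*` (`exists_mem_hull_add_comp_of_forall_apply_nonpos`).

If the `p k` are bounded along a subsequence, the limit of `-p k` is a limiting subgradient and
the multiplier rule follows. Otherwise the normalized `-p k` converge to a singular subgradient of
norm `1`, which contradicts the qualification condition.
-/

namespace SemiInfinite

/-! ### Convex cones in the dual space -/

section ConvexGeometry

/-- In finite dimension the convex hull of a compact set is compact: by Carathéodory's theorem it
is the image of `Δ × sⁿ⁺¹`, with `Δ` the standard simplex, under a continuous map. -/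
theorem isCompact_convexHull_of_isCompact {E : Type*} [NormedAddCommGroup E] [NormedSpace ℝ E]
    [FiniteDimensional ℝ E] {s : Set E} (hs : IsCompact s) : IsCompact (convexHull ℝ s) := by
  set n := Module.finrank ℝ E + 1
  have hK : IsCompact ((fun q : (Fin n → ℝ) × (Fin n → E) => ∑ i, q.1 i • q.2 i) ''
      (stdSimplex ℝ (Fin n) ×ˢ Set.univ.pi fun _ => s)) :=
    ((isCompact_stdSimplex ℝ (Fin n)).prod (isCompact_univ_pi fun _ => hs)).image (by fun_prop)
  convert hK
  apply Set.Subset.antisymm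
  · intro x hx
    rw [convexHull_eq_union] at hx
    simp only [Set.mem_iUnion] at hx
    obtain ⟨t, hts, hai, hxt⟩ := hx
    have hcard : Fintype.card t ≤ Fintype.card (Fin n) := by
      rw [Fintype.card_fin]
      exact hai.card_le_finrank_succ.trans
        (Nat.add_le_add_right (Submodule.finrank_le _) 1)
    have hne : Nonempty t := by
      obtain ⟨y, hy⟩ := convexHull_nonempty_iff.1 ⟨x, hxt⟩
      exact ⟨⟨y, hy⟩⟩
    obtain ⟨e⟩ := Function.Embedding.nonempty_of_card_le hcard
    set v : Fin n → E := fun i => (Function.invFun e i).1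
    have hv : Set.range v = (t : Set E) := by
      ext y
      constructor
      · rintro ⟨i, rfl⟩
        exact (Function.invFun e i).2
      · intro hy
        refine ⟨e ⟨y, hy⟩, ?_⟩
        simp only [v, Function.leftInverse_invFun e.injective _]
    have himg : convexHull ℝ (Set.range v) =
        Fintype.linearCombination ℝ v '' stdSimplex ℝ (Fin n) := by
      rw [← convexHull_rangle_single_eq_stdSimplex, LinearMap.image_convexHull, ← Set.range_comp]
      congr 2
      ext i
      simp [Fintype.linearCombination_apply_single]
    rw [← hv, himg] at hxt
    obtain ⟨w, hw, rfl⟩ := hxt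
    refine ⟨(w, v), ⟨hw, fun i _ => hts (hv ▸ Set.mem_range_self i)⟩, ?_⟩
    simp [Fintype.linearCombination_apply]
  · rintro _ ⟨⟨w, v⟩, ⟨hw, hv⟩, rfl⟩
    exact (convex_convexHull ℝ s).sum_mem (fun i _ => hw.1 i) hw.2
      fun i _ => subset_convexHull ℝ s (hv i trivial)

/-- In finite dimension every functional on the dual space is the evaluation at a point. -/
theorem exists_eval_of_finiteDimensional {X : Type*} [NormedAddCommGroup X] [NormedSpace ℝ X]
    [FiniteDimensional ℝ X] (Φ : StrongDual ℝ (StrongDual ℝ X)) :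
    ∃ w : X, ∀ c : StrongDual ℝ X, Φ c = c w := by
  let e : Module.Dual ℝ X ≃ₗ[ℝ] StrongDual ℝ X := LinearMap.toContinuousLinearMap
  refine ⟨(Module.evalEquiv ℝ X).symm (Φ.toLinearMap ∘ₗ e.toLinearMap), fun c => ?_⟩
  have h1 := Module.apply_evalEquiv_symm_apply (R := ℝ) (M := X) (c : X →ₗ[ℝ] ℝ)
    (Φ.toLinearMap ∘ₗ e.toLinearMap)
  refine Eq.trans ?_ h1.symm
  have : e (c : X →ₗ[ℝ] ℝ) = c := by ext; rfl
  simp [this]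

/-- A Farkas lemma for a compact family `G` of inequalities and the equation `A w = 0`, under a
Slater condition: it suffices to test `p` on solutions of the strict system. The Slater point `d`
allows the cone over `G` to be truncated to a compact convex set, which can be strictly separated
from the range of the adjoint of `A`. -/
theorem exists_mem_hull_add_comp_of_forall_apply_nonpos {X Y : Type*}
    [NormedAddCommGroup X] [NormedSpace ℝ X] [FiniteDimensional ℝ X]
    [NormedAddCommGroup Y] [NormedSpace ℝ Y] [FiniteDimensional ℝ Y]
    {A : X →L[ℝ] Y} {G : Set (StrongDual ℝ X)} (hG : IsCompact G) {d : X} (hAd : A d = 0)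
    (hGd : ∀ c ∈ G, c d < 0) {p : StrongDual ℝ X}
    (hp : ∀ w, A w = 0 → (∀ c ∈ G, c w < 0) → p w ≤ 0) :
    ∃ c ∈ PointedCone.hull ℝ G, ∃ y' : StrongDual ℝ Y, p = c + y'.comp A := by
  obtain ⟨m, hm, hGm⟩ : ∃ m : ℝ, 0 < m ∧ ∀ c ∈ G, c d ≤ -m := by
    rcases G.eq_empty_or_nonempty with rfl | hne
    · exact ⟨1, one_pos, by simp⟩
    · obtain ⟨c, hc, hmax⟩ := hG.exists_isMaxOn hne
        (f := fun c : StrongDual ℝ X => c d) (by fun_prop)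
      exact ⟨-(c d), by linarith [hGd c hc], fun c' hc' => by simpa using hmax hc'⟩
  -- Since `M * m > |p d|`, a point `w` with `p w > 0` and `c w < p w / M` on `G` can be moved
  -- along `d` until `c w < 0` on `G`, with `p w` still positive.
  set M : ℝ := (|p d| + 1) / m with hM
  have hM0 : 0 < M := by positivity
  have hMm : M * m = |p d| + 1 := by rw [hM]; field_simp
  set S : Set (StrongDual ℝ X) := (fun c => p - M • c) '' convexHull ℝ (insert 0 G) with hS
  set R : Submodule ℝ (StrongDual ℝ X) :=
    LinearMap.range (ContinuousLinearMap.precomp ℝ A : (Y →L[ℝ] ℝ) →L[ℝ] (X →L[ℝ] ℝ)).toLinearMap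
    with hR
  by_cases hdisj : Disjoint S (R : Set (StrongDual ℝ X))
  · exfalso
    have hSconv : Convex ℝ S := by
      have h2 := ((convex_convexHull ℝ (insert (0 : StrongDual ℝ X) G)).smul (-M)).translate p
      convert! h2 using 1
      rw [hS, ← Set.image_smul, Set.image_image]
      refine Set.image_congr fun c _ => ?_
      simp [sub_eq_add_neg]
    have hScomp : IsCompact S :=
      (isCompact_convexHull_of_isCompact (hG.insert 0)).image (by fun_prop)
    obtain ⟨Φ, a, b, hSa, hab, hRb⟩ := geometric_hahn_banach_compact_closed hSconv hScomp
      R.convex (Submodule.closed_of_finiteDimensional R) hdisj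
    obtain ⟨w, hw⟩ := exists_eval_of_finiteDimensional (-Φ)
    have hb : b < 0 := by simpa using hRb 0 R.zero_mem
    have hSw : ∀ c ∈ insert 0 G, 0 < p w - M * c w := by
      intro c hc
      have h1 := hSa _ ⟨c, subset_convexHull ℝ _ hc, rfl⟩
      have h2 := hw (p - M • c)
      simp only [neg_apply, sub_apply,
        smul_apply, smul_eq_mul] at h2
      simp only at h1
      linarith
    -- A functional bounded below on a subspace vanishes there.
    have hAw : A w = 0 := by
      refine (SeparatingDual.eq_zero_iff_forall_dual_eq_zero (R := ℝ) (A w)).2 fun y' => ?_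
      by_contra hy
      have h1 := hRb (((b - 1) / (-(y' (A w)))) • ContinuousLinearMap.precomp ℝ A y')
        (R.smul_mem _ ⟨y', rfl⟩)
      have h2 := hw (ContinuousLinearMap.precomp ℝ A y')
      have h3 : (ContinuousLinearMap.precomp ℝ A y') w = y' (A w) := rfl
      rw [h3, neg_apply] at h2
      have h4 : Φ (ContinuousLinearMap.precomp ℝ A y') = -(y' (A w)) := by linarith
      rw [map_smul, h4, smul_eq_mul, div_mul_cancel₀ _ (neg_ne_zero.2 hy)] at h1
      linarith
    have hpw : 0 < p w := by simpa using hSw 0 (Set.mem_insert _ _)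
    set σ : ℝ := p w / (M * m) with hσ
    have hσ0 : 0 < σ := by positivity
    have hσm : σ * m = p w / M := by rw [hσ]; field_simp
    have hσM : σ * (M * m) = p w := by rw [hσ]; field_simp
    have h := hp (w + σ • d) (by simp [hAw, hAd]) fun c hc => by
      have h1 := hSw c (Set.mem_insert_of_mem _ hc)
      have h2 : c w < p w / M := by rw [lt_div_iff₀ hM0]; linarith
      have h3 := mul_le_mul_of_nonneg_left (hGm c hc) hσ0.le
      simp only [map_add, map_smul, smul_eq_mul]
      linarith
    simp only [map_add, map_smul, smul_eq_mul] at h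
    have h3 : 0 < σ * (M * m + p d) := by
      apply mul_pos hσ0
      rw [hMm]
      linarith [neg_abs_le (p d)]
    linarith
  · obtain ⟨_, ⟨c, hc, rfl⟩, ⟨y', hy'⟩⟩ := Set.not_disjoint_iff.1 hdisj
    have hcK : c ∈ PointedCone.hull ℝ G := by
      refine convexHull_min (t := (PointedCone.hull ℝ G : Set (StrongDual ℝ X))) ?_ ?_ hc
      · rintro c (rfl | hc)
        · exact Submodule.zero_mem _
        · exact Submodule.subset_span hc
      · exact PointedCone.convex _
    refine ⟨M • c, PointedCone.smul_mem _ hM0.le hcK, y', ?_⟩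
    have h1 : y'.comp A = p - M • c := hy'
    rw [h1]
    abel

end ConvexGeometry

/-! ### Tangent directions and proximal normals of the feasible set -/

section Tangents

variable {X Y T : Type*} [NormedAddCommGroup X] [NormedSpace ℝ X]
  [NormedAddCommGroup Y] [NormedSpace ℝ Y]

/-- Kernel directions of a surjective strict derivative are tangent to the level set, uniformly
near the reference point. -/
theorem exists_near_direction_mem_levelSet [CompleteSpace X] [CompleteSpace Y]
    {h : X → Y} {A : X →L[ℝ] Y} {xbar w : X} (hh : HasStrictFDerivAt h A xbar)
    (hA : Function.Surjective A) (hw : A w = 0) {η : ℝ} (hη : 0 < η) :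
    ∃ δ > 0, ∀ x, ‖x - xbar‖ < δ → h x = 0 → ∀ τ, 0 < τ → τ < δ →
      ∃ w', ‖w' - w‖ ≤ η ∧ h (x + τ • w') = 0 := by
  have hA' : A.range = ⊤ := LinearMap.range_eq_top.2 hA
  set N := A.nonlinearRightInverseOfSurjective hA'
  have hN : 0 < (N.nnnorm : ℝ) := A.nonlinearRightInverseOfSurjective_nnnorm_pos hA'
  -- The approximation constant `c` is chosen such that `c * ‖w‖ = (N⁻¹ - c) * η`.
  set c : ℝ := (N.nnnorm : ℝ)⁻¹ * η / (‖w‖ + η) with hc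
  have hwη : 0 < ‖w‖ + η := by positivity
  have hc0 : 0 < c := by positivity
  have hcη : c * (‖w‖ + η) = (N.nnnorm : ℝ)⁻¹ * η := by rw [hc]; field_simp
  obtain ⟨s, hs, happ⟩ := hh.approximates_deriv_on_nhds (c := ⟨c, hc0.le⟩) (Or.inr hc0)
  obtain ⟨ρ, hρ, hρs⟩ := Metric.mem_nhds_iff.1 hs
  refine ⟨ρ / (1 + ‖w‖ + η), by positivity, fun x hx hx0 τ hτ hτδ => ?_⟩
  have hδ : ρ / (1 + ‖w‖ + η) * (1 + ‖w‖ + η) = ρ := by field_simp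
  have hb : Metric.closedBall (x + τ • w) (τ * η) ⊆ s := by
    intro z hz
    apply hρs
    rw [mem_closedBall_iff_norm] at hz
    rw [mem_ball_iff_norm]
    have h1 : z - xbar = (z - (x + τ • w)) + (τ • w + (x - xbar)) := by abel
    have h2 : ‖τ • w‖ = τ * ‖w‖ := by rw [norm_smul, Real.norm_of_nonneg hτ.le]
    have h3 := norm_add_le (z - (x + τ • w)) (τ • w + (x - xbar))
    have h4 := norm_add_le (τ • w) (x - xbar)
    have h5 := mul_le_mul_of_nonneg_right hτδ.le hwη.le
    rw [h1]
    nlinarith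
  have hsurj := happ.surjOn_closedBall_of_nonlinearRightInverse N (by positivity) hb
  have hxs : x ∈ s := by
    apply hρs
    rw [mem_ball_iff_norm]
    refine hx.trans_le (div_le_self hρ.le ?_)
    linarith [norm_nonneg w]
  have hxw : x + τ • w ∈ s := hb (Metric.mem_closedBall_self (by positivity))
  have hest := happ _ hxw _ hxs
  have h0 : (0 : Y) ∈ Metric.closedBall (h (x + τ • w))
      (((N.nnnorm : ℝ)⁻¹ - ((⟨c, hc0.le⟩ : NNReal) : ℝ)) * (τ * η)) := by
    rw [mem_closedBall_iff_norm, zero_sub, norm_neg]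
    simp only [add_sub_cancel_left, map_smul, hw, smul_zero, sub_zero, hx0, norm_smul,
      Real.norm_of_nonneg hτ.le] at hest ⊢
    change _ ≤ c * (τ * ‖w‖) at hest
    refine hest.trans (le_of_eq ?_)
    linear_combination τ * hcη
  obtain ⟨z, hz, hz0⟩ := hsurj h0
  refine ⟨τ⁻¹ • (z - x), ?_, ?_⟩
  · have h1 : τ⁻¹ • (z - x) - w = τ⁻¹ • (z - (x + τ • w)) := by
      rw [← sub_sub, smul_sub τ⁻¹ (z - x), inv_smul_smul₀ hτ.ne']
    rw [mem_closedBall_iff_norm] at hz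
    rw [h1, norm_smul, norm_inv, Real.norm_of_nonneg hτ.le, inv_mul_le_iff₀ hτ]
    exact hz
  · rw [smul_inv_smul₀ hτ.ne', add_sub_cancel, hz0]

/-- By compactness of the index set, strict descent directions of the active constraints preserve
the inequalities, with a step size independent of the index and of the feasible base point. -/
theorem exists_forall_constraint_nonpos_of_descent [TopologicalSpace T] [CompactSpace T]
    {g : T → X → ℝ} {xbar w : X} (hg_diff : ∀ t, Differentiable ℝ (g t))
    (hg_cont : Continuous fun p : X × T => g p.2 p.1)
    (hg'_cont : Continuous fun p : X × T => fderiv ℝ (g p.2) p.1)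
    (hx : ∀ t, g t xbar ≤ 0) (hw : ∀ t ∈ activeIndices g xbar, fderiv ℝ (g t) xbar w < 0) :
    ∃ δ > 0, ∀ x, ‖x - xbar‖ < δ → (∀ t, g t x ≤ 0) → ∀ τ, 0 < τ → τ < δ →
      ∀ w', ‖w' - w‖ ≤ δ → ∀ t, g t (x + τ • w') ≤ 0 := by
  -- Near an index, the constraint is uniformly inactive or `w` is uniformly a descent direction.
  have key : ∃ δ > 0, ∀ t ∈ (Set.univ : Set T), (∀ x ∈ Metric.ball xbar δ, g t x < 0) ∨
      ∀ x ∈ Metric.ball xbar δ, ∀ w' ∈ Metric.ball w δ, fderiv ℝ (g t) x w' < 0 := by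
    refine isCompact_univ.induction_on (p := fun S : Set T => ∃ δ > 0, ∀ t ∈ S,
      (∀ x ∈ Metric.ball xbar δ, g t x < 0) ∨
      ∀ x ∈ Metric.ball xbar δ, ∀ w' ∈ Metric.ball w δ, fderiv ℝ (g t) x w' < 0) ?_ ?_ ?_ ?_
    · exact ⟨1, one_pos, by simp⟩
    · rintro S S' hSS' ⟨δ, hδ, H⟩
      exact ⟨δ, hδ, fun t ht => H t (hSS' ht)⟩
    · rintro S S' ⟨δ, hδ, H⟩ ⟨δ', hδ', H'⟩
      have hb : ∀ z : X, Metric.ball z (min δ δ') ⊆ Metric.ball z δ :=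
        fun z => Metric.ball_subset_ball (min_le_left _ _)
      have hb' : ∀ z : X, Metric.ball z (min δ δ') ⊆ Metric.ball z δ' :=
        fun z => Metric.ball_subset_ball (min_le_right _ _)
      refine ⟨min δ δ', lt_min hδ hδ', ?_⟩
      rintro t (ht | ht)
      · exact (H t ht).imp (fun h x hx => h x (hb _ hx))
          fun h x hx w' hw' => h x (hb _ hx) w' (hb _ hw')
      · exact (H' t ht).imp (fun h x hx => h x (hb' _ hx))
          fun h x hx w' hw' => h x (hb' _ hx) w' (hb' _ hw')
    · intro t _
      rcases (hx t).lt_or_eq with hlt | heq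
      · have h1 : ∀ᶠ q : X × T in 𝓝 (xbar, t), g q.2 q.1 < 0 :=
          hg_cont.continuousAt.eventually_lt continuousAt_const hlt
        rw [nhds_prod_eq, eventually_prod_iff] at h1
        obtain ⟨pa, ha, pb, hb, hab⟩ := h1
        obtain ⟨δ, hδ, hδa⟩ := Metric.eventually_nhds_iff_ball.1 ha
        exact ⟨{s | pb s}, mem_nhdsWithin_of_mem_nhds hb, δ, hδ,
          fun s hs => Or.inl fun x hx => hab (hδa x hx) hs⟩
      · have hc : Continuous fun q : (X × X) × T => fderiv ℝ (g q.2) q.1.1 q.1.2 :=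
          (hg'_cont.comp (by fun_prop : Continuous fun q : (X × X) × T => (q.1.1, q.2))).clm_apply
            (by fun_prop)
        have h1 : ∀ᶠ q : (X × X) × T in 𝓝 ((xbar, w), t), fderiv ℝ (g q.2) q.1.1 q.1.2 < 0 :=
          hc.continuousAt.eventually_lt continuousAt_const (hw t heq)
        rw [nhds_prod_eq, eventually_prod_iff] at h1
        obtain ⟨pa, ha, pb, hb, hab⟩ := h1
        obtain ⟨δ, hδ, hδa⟩ := Metric.eventually_nhds_iff_ball.1 ha
        refine ⟨{s | pb s}, mem_nhdsWithin_of_mem_nhds hb, δ, hδ,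
          fun s hs => Or.inr fun x hx w' hw' => hab (hδa (x, w') ?_) hs⟩
        rw [← ball_prod_same]
        exact ⟨hx, hw'⟩
  obtain ⟨δ, hδ, H⟩ := key
  -- The step is short enough for the segment from `x` to `x + τ • w'` to stay in the ball.
  set δ' : ℝ := δ / (2 + ‖w‖ + δ) with hδ'
  have hδ'0 : 0 < δ' := by positivity
  have hδ'1 : δ' * (2 + ‖w‖ + δ) = δ := by rw [hδ']; field_simp
  have hlt : δ' < δ := by nlinarith [norm_nonneg w, mul_pos hδ'0 hδ]
  refine ⟨δ', hδ'0, fun x hx hgx τ hτ hτδ w' hw' t => ?_⟩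
  have hxb : x ∈ Metric.ball xbar δ := mem_ball_iff_norm.2 (hx.trans hlt)
  have hyb : x + τ • w' ∈ Metric.ball xbar δ := by
    rw [mem_ball_iff_norm]
    have h1 : x + τ • w' - xbar = (x - xbar) + τ • w' := by abel
    have h2 : ‖τ • w'‖ = τ * ‖w'‖ := by rw [norm_smul, Real.norm_of_nonneg hτ.le]
    have h3 : ‖w'‖ ≤ ‖w‖ + δ := by
      have := norm_add_le w (w' - w)
      rw [add_sub_cancel] at this
      linarith
    have h4 := norm_add_le (x - xbar) (τ • w')
    have h5 : τ * ‖w'‖ ≤ δ' * (‖w‖ + δ) :=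
      mul_le_mul hτδ.le h3 (norm_nonneg _) hδ'0.le
    rw [h1]
    nlinarith
  rcases H t trivial with h1 | h1
  · exact (h1 _ hyb).le
  · obtain ⟨z, hz, hzeq⟩ := domain_mvt (f := g t) (f' := fderiv ℝ (g t))
      (fun z _ => ((hg_diff t) z).hasFDerivAt.hasFDerivWithinAt)
      (convex_ball xbar δ) hxb hyb
    have h2 := h1 z ((convex_ball xbar δ).segment_subset hxb hyb hz) w'
      (mem_ball_iff_norm.2 (hw'.trans_lt hlt))
    rw [add_sub_cancel_left, map_smul, smul_eq_mul] at hzeq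
    nlinarith [hgx t, mul_neg_of_pos_of_neg hτ h2]

/-- A direction `w` in the kernel of `∇h(x̄)` along which all active constraints strictly decrease
belongs to the Clarke tangent cone of the feasible set at `x̄`. -/
theorem exists_near_direction_mem_feasibleSet [CompleteSpace X] [CompleteSpace Y]
    [TopologicalSpace T] [CompactSpace T]
    {g : T → X → ℝ} {h : X → Y} {xbar w : X} (hg_diff : ∀ t, Differentiable ℝ (g t))
    (hg_cont : Continuous fun p : X × T => g p.2 p.1)
    (hg'_cont : Continuous fun p : X × T => fderiv ℝ (g p.2) p.1)
    (hh : HasStrictFDerivAt h (fderiv ℝ h xbar) xbar)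
    (hA : Function.Surjective (fderiv ℝ h xbar))
    (hx : xbar ∈ feasibleSet g h) (hhw : fderiv ℝ h xbar w = 0)
    (hgw : ∀ t ∈ activeIndices g xbar, fderiv ℝ (g t) xbar w < 0) {η : ℝ} (hη : 0 < η) :
    ∃ δ > 0, ∀ x ∈ feasibleSet g h, ‖x - xbar‖ < δ → ∀ τ, 0 < τ → τ < δ →
      ∃ w', ‖w' - w‖ ≤ η ∧ x + τ • w' ∈ feasibleSet g h := by
  obtain ⟨δ₁, hδ₁, H₁⟩ := exists_forall_constraint_nonpos_of_descent hg_diff hg_cont hg'_cont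
    hx.2 hgw
  obtain ⟨δ₂, hδ₂, H₂⟩ := exists_near_direction_mem_levelSet hh hA hhw (lt_min hη hδ₁)
  refine ⟨min δ₁ δ₂, lt_min hδ₁ hδ₂, fun x hxf hxd τ hτ hτδ => ?_⟩
  obtain ⟨hxd₁, hxd₂⟩ := lt_min_iff.1 hxd
  obtain ⟨hτ₁, hτ₂⟩ := lt_min_iff.1 hτδ
  obtain ⟨w', hw', hw'0⟩ := H₂ x hxd₂ hxf.1 τ hτ hτ₂
  exact ⟨w', hw'.trans (min_le_left _ _), hw'0,
    H₁ x hxd₁ hxf.2 τ hτ hτ₁ w' (hw'.trans (min_le_right _ _))⟩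

/-- Limits of rescaled proximal normals are polar to the Clarke tangent cone. -/
theorem limit_proximalNormal_apply_nonpos {Ω : Set X} {xbar w : X}
    (hw : ∀ η > 0, ∃ δ > 0, ∀ x ∈ Ω, ‖x - xbar‖ < δ → ∀ τ, 0 < τ → τ < δ →
      ∃ w', ‖w' - w‖ ≤ η ∧ x + τ • w' ∈ Ω)
    {x : ℕ → X} {p : ℕ → StrongDual ℝ X} {κ c : ℕ → ℝ} {P : StrongDual ℝ X} {r : ℝ} (hr : 0 < r)
    (hx : Tendsto x atTop (𝓝 xbar)) (hxΩ : ∀ n, x n ∈ Ω)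
    (hp : ∀ n, ∀ z ∈ Ω ∩ Metric.closedBall xbar r, p n (z - x n) ≤ κ n * ‖z - x n‖ ^ 2)
    (hκ : ∀ n, 0 ≤ κ n) (hc : ∀ n, 0 ≤ c n) (hcp : ∀ n, c n * ‖p n‖ ≤ 1)
    (hP : ∀ v, Tendsto (fun n => c n * p n v) atTop (𝓝 (P v))) : P w ≤ 0 := by
  refine le_of_forall_pos_le_add fun η hη => ?_
  rw [zero_add]
  obtain ⟨δ, hδ, H⟩ := hw η hη
  refine le_of_tendsto (hP w) ?_
  have h1 := (tendsto_iff_norm_sub_tendsto_zero.1 hx).eventually_lt_const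
    (lt_min hδ (half_pos hr))
  filter_upwards [h1] with n hn
  obtain ⟨hn1, hn2⟩ := lt_min_iff.1 hn
  set b := ‖w‖ + η
  have hb : 0 < b := by positivity
  have hstep : ∀ᶠ τ : ℝ in 𝓝[>] 0, p n w ≤ ‖p n‖ * η + κ n * τ * b ^ 2 := by
    have hm : 0 < min δ (r / (2 * b)) := lt_min hδ (by positivity)
    filter_upwards [Ioo_mem_nhdsGT hm] with τ hτ
    obtain ⟨hτ1, hτ2⟩ := lt_min_iff.1 hτ.2
    have hτ0 : 0 < τ := hτ.1
    obtain ⟨w', hw', hw'Ω⟩ := H (x n) (hxΩ n) hn1 τ hτ0 hτ1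
    have hw'b : ‖w'‖ ≤ b := by
      have := norm_add_le w (w' - w)
      rw [add_sub_cancel] at this
      linarith
    have hτw : ‖τ • w'‖ ≤ τ * b := by
      rw [norm_smul, Real.norm_of_nonneg hτ0.le]
      exact mul_le_mul_of_nonneg_left hw'b hτ0.le
    have hball : x n + τ • w' ∈ Metric.closedBall xbar r := by
      rw [mem_closedBall_iff_norm]
      have e1 : x n + τ • w' - xbar = (x n - xbar) + τ • w' := by abel
      have e2 := norm_add_le (x n - xbar) (τ • w')
      have e3 : τ * b ≤ r / 2 := by
        rw [lt_div_iff₀ (by positivity)] at hτ2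
        linarith
      rw [e1]
      linarith
    have h2 := hp n _ ⟨hw'Ω, hball⟩
    rw [add_sub_cancel_left, map_smul, smul_eq_mul] at h2
    have h3 : κ n * ‖τ • w'‖ ^ 2 ≤ κ n * (τ * b) ^ 2 :=
      mul_le_mul_of_nonneg_left (pow_le_pow_left₀ (norm_nonneg _) hτw 2) (hκ n)
    have h4 : p n w' ≤ κ n * τ * b ^ 2 := by
      refine le_of_mul_le_mul_left ?_ hτ0
      calc τ * p n w' ≤ κ n * (τ * b) ^ 2 := h2.trans h3
        _ = τ * (κ n * τ * b ^ 2) := by ring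
    have h5 : p n (w - w') ≤ ‖p n‖ * η := by
      refine (le_abs_self _).trans (((p n).le_opNorm _).trans ?_)
      rw [norm_sub_rev]
      exact mul_le_mul_of_nonneg_left hw' (norm_nonneg _)
    rw [map_sub] at h5
    linarith
  have hlim : Tendsto (fun τ : ℝ => ‖p n‖ * η + κ n * τ * b ^ 2) (𝓝[>] 0)
      (𝓝 (‖p n‖ * η + κ n * 0 * b ^ 2)) :=
    (Continuous.tendsto (by fun_prop) 0).mono_left nhdsWithin_le_nhds
  have h6 := ge_of_tendsto hlim hstep
  rw [mul_zero, zero_mul, add_zero] at h6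
  calc c n * p n w ≤ c n * (‖p n‖ * η) := mul_le_mul_of_nonneg_left h6 (hc n)
    _ = (c n * ‖p n‖) * η := by ring
    _ ≤ 1 * η := mul_le_mul_of_nonneg_right (hcp n) hη.le
    _ = η := one_mul η

end Tangents

/-! ### Penalization -/

section Penalization

variable {X : Type*} [NormedAddCommGroup X] [NormedSpace ℝ X]

/-- Fermat's rule for a sum `φ + s` with `s` differentiable. -/
theorem neg_mem_epsSubdifferential_of_add_isLocalMin {φ : X → EReal} {s : X → ℝ}
    {s' : StrongDual ℝ X} {x : X} (hbot : ∀ u, φ u ≠ ⊥) (htop : φ x ≠ ⊤) (hs : HasFDerivAt s s' x)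
    (hmin : ∀ᶠ u in 𝓝 x, φ x + (s x : EReal) ≤ φ u + (s u : EReal)) {ε : ℝ} (hε : 0 < ε) :
    -s' ∈ epsSubdifferential ε φ x := by
  refine ⟨htop, le_liminf_of_le (by isBoundedDefault) ?_⟩
  filter_upwards [nhdsWithin_le_nhds (hs.isLittleO.def hε), nhdsWithin_le_nhds hmin,
    self_mem_nhdsWithin] with u h1 h2 h3
  have hpos : 0 < ‖u - x‖ := norm_sub_pos_iff.2 h3
  rw [EReal.le_div_iff_mul_le (by exact_mod_cast hpos) (EReal.coe_ne_top _)]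
  rw [Real.norm_eq_abs] at h1
  have h4 := (abs_le.1 h1).2
  obtain ⟨a, ha⟩ : ∃ a : ℝ, φ x = a := ⟨_, (EReal.coe_toReal htop (hbot x)).symm⟩
  rw [ha] at h2 ⊢
  by_cases hu : φ u = ⊤
  · rw [hu, EReal.top_sub_coe, EReal.top_sub_coe]
    exact le_top
  · obtain ⟨b, hb⟩ : ∃ b : ℝ, φ u = b := ⟨_, (EReal.coe_toReal hu (hbot u)).symm⟩
    rw [hb] at h2 ⊢
    norm_cast at h2 ⊢
    simp only [neg_apply]
    linarith

variable [FiniteDimensional ℝ X]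

/-- The square of a Euclidean distance from `a` to `u`. The norm of `X` need not be differentiable
off `0`, so penalty terms use an auxiliary Euclidean norm. -/
noncomputable def euclideanSqDist (a u : X) : ℝ :=
  ‖toEuclidean (u - a)‖ ^ 2

/-- The derivative of `euclideanSqDist a` at `u`. -/
noncomputable def euclideanSqDistDeriv (a u : X) : StrongDual ℝ X :=
  (2 : ℝ) • (innerSL ℝ (toEuclidean (u - a))).comp
    (toEuclidean : X ≃L[ℝ] EuclideanSpace ℝ (Fin (Module.finrank ℝ X))).toContinuousLinearMap

theorem hasFDerivAt_euclideanSqDist (a u : X) :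
    HasFDerivAt (euclideanSqDist a) (euclideanSqDistDeriv a u) u := by
  have h1 : HasFDerivAt (fun u : X => toEuclidean (u - a))
      (toEuclidean : X ≃L[ℝ] EuclideanSpace ℝ (Fin (Module.finrank ℝ X))).toContinuousLinearMap
      u := by
    have h2 := (toEuclidean : X ≃L[ℝ] EuclideanSpace ℝ
      (Fin (Module.finrank ℝ X))).toContinuousLinearMap.hasFDerivAt.comp u
      ((hasFDerivAt_id u).sub_const a)
    rwa [ContinuousLinearMap.comp_id] at h2
  refine h1.norm_sq.congr_fderiv ?_
  rw [euclideanSqDistDeriv, ← ofNat_smul_eq_nsmul ℝ]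

theorem continuous_euclideanSqDist : Continuous fun q : X × X => euclideanSqDist q.1 q.2 := by
  unfold euclideanSqDist
  fun_prop

theorem continuous_euclideanSqDistDeriv (a : X) : Continuous (euclideanSqDistDeriv a) := by
  unfold euclideanSqDistDeriv
  fun_prop

theorem tendsto_euclideanSqDist {ι : Type*} {l : Filter ι} {x u : ι → X} {a v : X}
    (hx : Tendsto x l (𝓝 a)) (hu : Tendsto u l (𝓝 v)) :
    Tendsto (fun i => euclideanSqDist (x i) (u i)) l (𝓝 (euclideanSqDist a v)) :=
  Tendsto.comp (g := fun q : X × X => euclideanSqDist q.1 q.2) (f := fun i => (x i, u i))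
    (continuous_euclideanSqDist.tendsto (a, v)) (hx.prodMk_nhds hu)

@[simp]
theorem euclideanSqDist_self (a : X) : euclideanSqDist a a = 0 := by
  simp [euclideanSqDist]

@[simp]
theorem euclideanSqDistDeriv_self (a : X) : euclideanSqDistDeriv a a = 0 := by
  ext
  simp [euclideanSqDistDeriv]

theorem euclideanSqDist_nonneg (a u : X) : 0 ≤ euclideanSqDist a u := by
  unfold euclideanSqDist
  positivity

theorem eq_of_euclideanSqDist_eq_zero {a u : X} (h : euclideanSqDist a u = 0) : u = a := by
  simpa [euclideanSqDist, sub_eq_zero] using h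

/-- Nearest points give proximal normals: expansion of the square in the base point. -/
theorem exists_euclideanSqDistDeriv_apply_le (X : Type*) [NormedAddCommGroup X] [NormedSpace ℝ X]
    [FiniteDimensional ℝ X] :
    ∃ C : ℝ, 0 ≤ C ∧ ∀ x z u : X, euclideanSqDist x u ≤ euclideanSqDist z u →
      euclideanSqDistDeriv x u (z - x) ≤ C * ‖z - x‖ ^ 2 := by
  set L := (toEuclidean : X ≃L[ℝ] EuclideanSpace ℝ (Fin (Module.finrank ℝ X))).toContinuousLinearMap
    with hL
  refine ⟨‖L‖ ^ 2, by positivity, fun x z u h => ?_⟩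
  have h1 : euclideanSqDist z u = ‖L (u - x) - L (z - x)‖ ^ 2 := by
    rw [← map_sub, sub_sub_sub_cancel_right]
    rfl
  have h2 : euclideanSqDist x u = ‖L (u - x)‖ ^ 2 := rfl
  have h3 : euclideanSqDistDeriv x u (z - x) = 2 * inner ℝ (L (u - x)) (L (z - x)) := by
    rw [euclideanSqDistDeriv, smul_apply, smul_eq_mul]
    rfl
  rw [h1, h2, norm_sub_sq_real] at h
  have h4 : ‖L (z - x)‖ ^ 2 ≤ (‖L‖ * ‖z - x‖) ^ 2 :=
    pow_le_pow_left₀ (norm_nonneg _) (L.le_opNorm _) 2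
  rw [mul_pow] at h4
  rw [h3]
  linarith

/-- Decoupling of a constrained minimum. Minimizing
`f u + (k + 1) * |u - x|² + |u - x̄|²` over `u` near `x̄` and `x ∈ Ω` near `x̄` yields points
`u k → x̄` and `x k → x̄` with multipliers `p k`, where `-p k` is up to a small error `e k` a
subgradient of `f` at `u k`, and `p k` is a proximal normal to `Ω` at `x k`. -/
theorem exists_subgradient_proximalNormal_sequences {f : X → EReal} {Ω : Set X} {xbar : X}
    (hbot : ∀ u, f u ≠ ⊥) (htop : f xbar ≠ ⊤) (hxΩ : xbar ∈ Ω) (hmin : IsLocalMinOn f Ω xbar)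
    (hlsc : ∀ᶠ x in 𝓝 xbar, LowerSemicontinuousAt f x)
    (hΩ : ∃ ρ > 0, IsClosed (Ω ∩ Metric.closedBall xbar ρ)) :
    ∃ (u x : ℕ → X) (p e : ℕ → StrongDual ℝ X) (κ : ℕ → ℝ) (r : ℝ), 0 < r ∧
      Tendsto u atTop (𝓝 xbar) ∧ Tendsto x atTop (𝓝 xbar) ∧
      Tendsto (fun n => f (u n)) atTop (𝓝 (f xbar)) ∧ (∀ n, x n ∈ Ω) ∧
      Tendsto e atTop (𝓝 0) ∧ (∀ n, 0 ≤ κ n) ∧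
      (∀ n, ∀ ε > 0, -(p n + e n) ∈ epsSubdifferential ε f (u n)) ∧
      ∀ n, ∀ z ∈ Ω ∩ Metric.closedBall xbar r, p n (z - x n) ≤ κ n * ‖z - x n‖ ^ 2 := by
  obtain ⟨ρ, hρ, hΩρ⟩ := hΩ
  obtain ⟨r₀, hr₀, hB⟩ := Metric.nhds_basis_closedBall.eventually_iff.1
    (hlsc.and (eventually_nhdsWithin_iff.1 hmin))
  set r := min ρ r₀
  have hr : 0 < r := lt_min hρ hr₀
  set B := Metric.closedBall xbar r
  have hBr : B ⊆ Metric.closedBall xbar r₀ := Metric.closedBall_subset_closedBall (min_le_right _ _)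
  have hlscB : ∀ u ∈ B, LowerSemicontinuousAt f u := fun u hu => (hB (hBr hu)).1
  have hminB : ∀ u ∈ B, u ∈ Ω → f xbar ≤ f u := fun u hu => (hB (hBr hu)).2
  have hxB : xbar ∈ B := Metric.mem_closedBall_self hr.le
  have hBc : IsCompact B := isCompact_closedBall _ _
  have hCc : IsCompact (Ω ∩ B) := by
    have : Ω ∩ B = B ∩ (Ω ∩ Metric.closedBall xbar ρ) := by
      have : B ⊆ Metric.closedBall xbar ρ := Metric.closedBall_subset_closedBall (min_le_left _ _)
      ext z
      exact ⟨fun h => ⟨h.2, h.1, this h.2⟩, fun h => ⟨h.2.1, h.1⟩⟩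
    rw [this]
    exact hBc.inter_right hΩρ
  obtain ⟨a, ha⟩ : ∃ a : ℝ, f xbar = a := ⟨_, (EReal.coe_toReal htop (hbot xbar)).symm⟩
  obtain ⟨m, hm⟩ : ∃ m : ℝ, ∀ u ∈ B, (m : EReal) ≤ f u := by
    obtain ⟨u₀, -, hu₀⟩ := LowerSemicontinuousOn.exists_isMinOn ⟨xbar, hxB⟩ hBc
      (f := f) fun u hu => (hlscB u hu).lowerSemicontinuousWithinAt B
    have h1 : f u₀ ≠ ⊤ := ((hu₀ hxB).trans_lt (lt_top_iff_ne_top.2 htop)).ne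
    exact ⟨(f u₀).toReal, fun u hu => (EReal.coe_toReal h1 (hbot u₀)).le.trans (hu₀ hu)⟩
  -- The penalized problems and their minimizers.
  let s : ℕ → X × X → ℝ := fun k z =>
    ((k : ℝ) + 1) * euclideanSqDist z.2 z.1 + euclideanSqDist xbar z.1
  have hs : ∀ k, Continuous (s k) := by
    intro k
    have h1 : Continuous fun z : X × X => euclideanSqDist z.2 z.1 :=
      continuous_euclideanSqDist.comp (g := fun q : X × X => euclideanSqDist q.1 q.2)
        (f := fun z : X × X => (z.2, z.1)) (by fun_prop)
    have h2 : Continuous fun z : X × X => euclideanSqDist xbar z.1 :=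
      continuous_euclideanSqDist.comp (g := fun q : X × X => euclideanSqDist q.1 q.2)
        (f := fun z : X × X => (xbar, z.1)) (by fun_prop)
    exact (continuous_const.mul h1).add h2
  have hex : ∀ k, ∃ z ∈ B ×ˢ (Ω ∩ B),
      IsMinOn (fun z : X × X => f z.1 + (s k z : EReal)) (B ×ˢ (Ω ∩ B)) z := by
    intro k
    refine LowerSemicontinuousOn.exists_isMinOn ⟨(xbar, xbar), hxB, hxΩ, hxB⟩ (hBc.prod hCc) ?_
    refine LowerSemicontinuousOn.add' (f := fun z : X × X => f z.1) ?_ ?_ ?_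
    · intro z hz
      exact LowerSemicontinuousAt.lowerSemicontinuousWithinAt _
        fun c hc => (continuous_fst.tendsto z).eventually (hlscB z.1 hz.1 c hc)
    · exact ((continuous_coe_real_ereal.comp (hs k)).lowerSemicontinuous).lowerSemicontinuousOn _
    · intro z _
      exact EReal.continuousAt_add (Or.inr (EReal.coe_ne_bot _)) (Or.inl (hbot _))
  obtain ⟨C, hC0, hC⟩ := exists_euclideanSqDistDeriv_apply_le X
  choose z hzD hzmin using hex
  have hztop : ∀ k, f (z k).1 ≠ ⊤ := by
    intro k hk
    have h1 := hzmin k (show (xbar, xbar) ∈ B ×ˢ (Ω ∩ B) from ⟨hxB, hxΩ, hxB⟩)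
    simp only [Set.mem_ofPred_eq, hk, ha, EReal.top_add_coe, ← EReal.coe_add, top_le_iff] at h1
    exact EReal.coe_ne_top _ h1
  choose b hb using fun k => (⟨_, (EReal.coe_toReal (hztop k) (hbot _)).symm⟩ :
    ∃ b : ℝ, f (z k).1 = b)
  have hba : ∀ k, b k + s k (z k) ≤ a := by
    intro k
    have h1 := hzmin k (show (xbar, xbar) ∈ B ×ˢ (Ω ∩ B) from ⟨hxB, hxΩ, hxB⟩)
    simp only [Set.mem_ofPred_eq, hb, ha, ← EReal.coe_add, EReal.coe_le_coe_iff] at h1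
    simpa [s] using h1
  have hmb : ∀ k, m ≤ b k := fun k => by
    have h1 := hm _ (hzD k).1
    rw [hb] at h1
    exact_mod_cast h1
  have hsq : ∀ k : ℕ, euclideanSqDist (z k).2 (z k).1 ≤ (a - m) * (1 / ((k : ℝ) + 1)) := by
    intro k
    have h1 := hba k
    have h2 := hmb k
    have h3 := euclideanSqDist_nonneg xbar (z k).1
    have hk : (0 : ℝ) < k + 1 := by positivity
    simp only [s] at h1
    rw [mul_one_div, le_div_iff₀ hk]
    linarith
  obtain ⟨⟨v, y⟩, hvy, ψ, hψ, hlim⟩ := (hBc.prod hCc).tendsto_subseq hzD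
  have hlimu : Tendsto (fun n => (z (ψ n)).1) atTop (𝓝 v) := (continuous_fst.tendsto _).comp hlim
  have hlimx : Tendsto (fun n => (z (ψ n)).2) atTop (𝓝 y) := (continuous_snd.tendsto _).comp hlim
  have hvy_eq : v = y := by
    apply eq_of_euclideanSqDist_eq_zero
    have h1 : Tendsto (fun n => euclideanSqDist (z (ψ n)).2 (z (ψ n)).1) atTop
        (𝓝 (euclideanSqDist y v)) :=
      tendsto_euclideanSqDist hlimx hlimu
    have h2 : Tendsto (fun n => (a - m) * (1 / ((ψ n : ℝ) + 1))) atTop (𝓝 ((a - m) * 0)) :=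
      (tendsto_one_div_add_atTop_nhds_zero_nat.comp hψ.tendsto_atTop).const_mul _
    rw [mul_zero] at h2
    exact le_antisymm (le_of_tendsto_of_tendsto' h1 h2 fun n => hsq (ψ n))
      (euclideanSqDist_nonneg _ _)
  subst hvy_eq
  have hbound : ∀ k, b k + euclideanSqDist xbar (z k).1 ≤ a := by
    intro k
    have h1 := hba k
    have h2 : 0 ≤ ((k : ℝ) + 1) * euclideanSqDist (z k).2 (z k).1 :=
      mul_nonneg (by positivity) (euclideanSqDist_nonneg _ _)
    simp only [s] at h1
    linarith
  have hv : v = xbar := by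
    apply eq_of_euclideanSqDist_eq_zero
    by_contra hne
    have hpos : 0 < euclideanSqDist xbar v := lt_of_le_of_ne (euclideanSqDist_nonneg _ _)
      (Ne.symm hne)
    have h1 : Tendsto (fun n => euclideanSqDist xbar (z (ψ n)).1) atTop
        (𝓝 (euclideanSqDist xbar v)) :=
      tendsto_euclideanSqDist tendsto_const_nhds hlimu
    have h2 : ((a - euclideanSqDist xbar v / 2 : ℝ) : EReal) < f v := by
      refine lt_of_lt_of_le ?_ (hminB v hvy.1 hvy.2.1)
      rw [ha, EReal.coe_lt_coe_iff]
      linarith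
    obtain ⟨n, h3, h4⟩ := ((hlimu.eventually (hlscB v hvy.1 _ h2)).and
      (h1.eventually_const_lt (half_lt_self hpos))).exists
    rw [hb, gt_iff_lt, EReal.coe_lt_coe_iff] at h3
    linarith [hbound (ψ n)]
  subst hv
  have hlimf : Tendsto (fun n => f (z (ψ n)).1) atTop (𝓝 (f v)) := by
    refine tendsto_order.2 ⟨fun c hc => hlimu.eventually (hlscB v hxB c hc), fun c hc => ?_⟩
    refine Eventually.of_forall fun n => lt_of_le_of_lt ?_ hc
    rw [hb, ha, EReal.coe_le_coe_iff]
    linarith [hbound (ψ n), euclideanSqDist_nonneg v (z (ψ n)).1]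
  -- The subgradient relation needs `u` in the interior of the ball, which holds eventually.
  obtain ⟨N, hN⟩ := eventually_atTop.1 (hlimu.eventually (Metric.ball_mem_nhds v hr))
  have hshift : Tendsto (fun n : ℕ => n + N) atTop atTop := tendsto_add_atTop_nat N
  set k : ℕ → ℕ := fun n => ψ (n + N)
  refine ⟨fun n => (z (k n)).1, fun n => (z (k n)).2,
    fun n => ((k n : ℝ) + 1) • euclideanSqDistDeriv (z (k n)).2 (z (k n)).1,
    fun n => euclideanSqDistDeriv v (z (k n)).1,
    fun n => ((k n : ℝ) + 1) * C, r, hr, hlimu.comp hshift, hlimx.comp hshift, hlimf.comp hshift,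
    fun n => (hzD _).2.1,
    ?_, fun n => by positivity, ?_, ?_⟩
  · have h1 := (continuous_euclideanSqDistDeriv v).tendsto v
    rw [euclideanSqDistDeriv_self] at h1
    exact h1.comp (hlimu.comp hshift)
  · intro n ε hε
    refine neg_mem_epsSubdifferential_of_add_isLocalMin
      (s := fun u => s (k n) (u, (z (k n)).2)) hbot (hztop _) ?_ ?_ hε
    · exact ((hasFDerivAt_euclideanSqDist _ _).const_mul ((k n : ℝ) + 1)).add
        (hasFDerivAt_euclideanSqDist _ _)
    · have h1 : Metric.ball v r ∈ 𝓝 (z (k n)).1 :=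
        Metric.isOpen_ball.mem_nhds (hN (n + N) (Nat.le_add_left _ _))
      filter_upwards [h1] with u hu
      exact hzmin (k n) (show (u, (z (k n)).2) ∈ B ×ˢ (Ω ∩ B) from
        ⟨Metric.ball_subset_closedBall hu, (hzD _).2⟩)
  · intro n w hw
    have hk : (0 : ℝ) < (k n : ℝ) + 1 := by positivity
    have h1 := hzmin (k n) (show ((z (k n)).1, w) ∈ B ×ˢ (Ω ∩ B) from ⟨(hzD _).1, hw⟩)
    simp only [Set.mem_ofPred_eq, hb, ← EReal.coe_add, EReal.coe_le_coe_iff, s] at h1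
    have h2 : euclideanSqDist (z (k n)).2 (z (k n)).1 ≤ euclideanSqDist w (z (k n)).1 :=
      le_of_mul_le_mul_left (by linarith) hk
    have h3 := mul_le_mul_of_nonneg_left (hC _ _ _ h2) hk.le
    rw [smul_apply, smul_eq_mul, mul_assoc]
    exact h3

end Penalization

/-! ### Compactness of the constraint data and the multiplier rule -/

section Multipliers

variable {X Y T : Type*} [NormedAddCommGroup X] [NormedSpace ℝ X]
  [NormedAddCommGroup Y] [NormedSpace ℝ Y]

/-- Strict differentiability of `h` at one point makes the feasible set locally closed there. -/
theorem exists_isClosed_feasibleSet_inter_closedBall {g : T → X → ℝ} {h : X → Y} {xbar : X}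
    {A : X →L[ℝ] Y} (hg : ∀ t, Continuous (g t)) (hh : HasStrictFDerivAt h A xbar) :
    ∃ ρ > 0, IsClosed (feasibleSet g h ∩ Metric.closedBall xbar ρ) := by
  obtain ⟨s, hs, happ⟩ := hh.approximates_deriv_on_nhds (c := 1) (Or.inr one_pos)
  obtain ⟨ρ, hρ, hρs⟩ := Metric.nhds_basis_closedBall.mem_iff.1 hs
  refine ⟨ρ, hρ, ?_⟩
  have h1 : IsClosed (Metric.closedBall xbar ρ ∩ h ⁻¹' {0}) :=
    (happ.continuousOn.mono hρs).preimage_isClosed_of_isClosed Metric.isClosed_closedBall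
      isClosed_singleton
  have h2 : IsClosed (⋂ t, {x | g t x ≤ 0}) :=
    isClosed_iInter fun t => isClosed_le (hg t) continuous_const
  convert h1.inter h2 using 1
  ext x
  simp only [feasibleSet, Set.mem_inter_iff, Set.mem_ofPred_eq, Set.mem_preimage,
    Set.mem_singleton_iff, Set.mem_iInter]
  tauto

theorem isCompact_activeGradients [TopologicalSpace T] [CompactSpace T] {g : T → X → ℝ}
    (hg_cont : Continuous fun p : X × T => g p.2 p.1)
    (hg'_cont : Continuous fun p : X × T => fderiv ℝ (g p.2) p.1) (x : X) :
    IsCompact ((fun t => fderiv ℝ (g t) x) '' activeIndices g x) := by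
  have hemb : Continuous fun t : T => (x, t) := by fun_prop
  have hcl : IsClosed (activeIndices g x) :=
    isClosed_eq (hg_cont.comp hemb) continuous_const
  exact hcl.isCompact.image (hg'_cont.comp hemb)

theorem exists_finsupp_of_mem_activeGradientCone {g : T → X → ℝ} {x : X} {c : StrongDual ℝ X}
    (hc : c ∈ activeGradientCone g x) :
    ∃ lam : T →₀ ℝ, (∀ t, 0 ≤ lam t) ∧ (∀ t, lam t ≠ 0 → t ∈ activeIndices g x) ∧
      (lam.sum fun t a => a • fderiv ℝ (g t) x) = c := by
  obtain ⟨l, hl, hlc⟩ := (Finsupp.mem_span_image_iff_linearCombination _).1 hc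
  refine ⟨l.mapRange (fun a : {a : ℝ // 0 ≤ a} => (a : ℝ)) rfl, fun t => (l t).2, fun t ht => ?_, ?_⟩
  · refine (Finsupp.mem_supported _ _).1 hl (Finsupp.mem_support_iff.2 fun h => ht ?_)
    rw [Finsupp.mapRange_apply, h]
    rfl
  · rw [Finsupp.sum_mapRange_index (by simp), ← hlc]
    rfl

end Multipliers

end SemiInfinite

theorem corollary5p6 {X Y T : Type*}
    [NormedAddCommGroup X] [NormedSpace ℝ X] [FiniteDimensional ℝ X]
    [NormedAddCommGroup Y] [NormedSpace ℝ Y] [FiniteDimensional ℝ Y]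
    (hdim : Module.finrank ℝ Y < Module.finrank ℝ X)
    [MetricSpace T] [CompactSpace T]
    (f : X → EReal) (hf_bot : ∀ x, f x ≠ ⊥)
    (g : T → X → ℝ) (h : X → Y) (xbar : X)
    -- `g` and its gradient exist and are jointly continuous on `X × T`
    (hg_diff : ∀ t, Differentiable ℝ (g t))
    (hg_cont : Continuous fun p : X × T => g p.2 p.1)
    (hg'_cont : Continuous fun p : X × T => fderiv ℝ (g p.2) p.1)
    -- `h` is strictly differentiable at `xbar`
    (hh : HasStrictFDerivAt h (fderiv ℝ h xbar) xbar)
    -- `xbar` is a local minimizer, with finite optimal value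
    (hx_feas : xbar ∈ SemiInfinite.feasibleSet g h)
    (hx_dom : f xbar ≠ ⊤)
    (hx_min : IsLocalMinOn f (SemiInfinite.feasibleSet g h) xbar)
    -- `f` is lower semicontinuous around `xbar`
    (hf_lsc : ∀ᶠ x in 𝓝 xbar, LowerSemicontinuousAt f x)
    (hqual : SemiInfinite.singularSubdifferential f xbar ∩
      (-SemiInfinite.activeGradientCone g xbar - SemiInfinite.adjointRange h xbar) = {0})
    (hemfcq : SemiInfinite.EMFCQ g h xbar) :
    ∃ (lam : T →₀ ℝ) (y' : StrongDual ℝ Y),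
      (∀ t, 0 ≤ lam t) ∧
      (∀ t, lam t ≠ 0 → t ∈ SemiInfinite.activeIndices g xbar) ∧
      ∃ x' ∈ SemiInfinite.limitingSubdifferential f xbar,
        x' + (lam.sum fun t c => c • fderiv ℝ (g t) xbar) + y'.comp (fderiv ℝ h xbar) = 0 := by
  have : CompleteSpace X := FiniteDimensional.complete ℝ X
  have : CompleteSpace Y := FiniteDimensional.complete ℝ Y
  have : ProperSpace (StrongDual ℝ X) := FiniteDimensional.proper ℝ _
  obtain ⟨hsurj, d, hhd, hgd⟩ := hemfcq
  obtain ⟨u, x, p, e, κ, r, hr, hu, hx, hfu, hxΩ, he, hκ, hsub, hprox⟩ :=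
    SemiInfinite.exists_subgradient_proximalNormal_sequences hf_bot hx_dom hx_feas hx_min hf_lsc
      (SemiInfinite.exists_isClosed_feasibleSet_inter_closedBall
        (fun t => (hg_diff t).continuous) hh)
  -- The scaling `c n = 1 / (1 + ‖p n‖)` treats bounded and unbounded multipliers at once:
  -- `c n` stays away from `0` along a subsequence exactly when `p n` stays bounded along it.
  set c : ℕ → ℝ := fun n => (1 + ‖p n‖)⁻¹
  have hc0 : ∀ n, 0 < c n := fun n => by positivity
  have hcp : ∀ n, c n + c n * ‖p n‖ = 1 := fun n => by
    have : (1 + ‖p n‖) ≠ 0 := by positivity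
    rw [← mul_one_add, inv_mul_cancel₀ this]
  have hcp1 : ∀ n, c n * ‖p n‖ ≤ 1 := fun n => by linarith [hcp n, hc0 n]
  have hnorm : ∀ n, ‖c n • p n‖ = c n * ‖p n‖ := fun n => by
    rw [norm_smul, Real.norm_of_nonneg (hc0 n).le]
  obtain ⟨⟨c₀, P⟩, hcP, ψ, hψ, hlim⟩ :=
    ((isCompact_Icc (a := (0 : ℝ)) (b := 1)).prod
      (isCompact_closedBall (0 : StrongDual ℝ X) 1)).tendsto_subseq
      (x := fun n => (c n, c n • p n)) fun n =>
        ⟨⟨(hc0 n).le, by nlinarith [hcp n, hc0 n, norm_nonneg (p n)]⟩,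
          mem_closedBall_zero_iff.2 ((hnorm n).trans_le (hcp1 n))⟩
  have hlimc : Tendsto (fun n => c (ψ n)) atTop (𝓝 c₀) := (continuous_fst.tendsto _).comp hlim
  have hlimP : Tendsto (fun n => c (ψ n) • p (ψ n)) atTop (𝓝 P) :=
    (continuous_snd.tendsto _).comp hlim
  have hψt := hψ.tendsto_atTop
  have hlimPv : ∀ v, Tendsto (fun n => c (ψ n) * p (ψ n) v) atTop (𝓝 (P v)) := fun v =>
    ((ContinuousLinearMap.apply ℝ ℝ v).continuous.tendsto P).comp hlimP
  have hlime : ∀ v, Tendsto (fun n => e (ψ n) v) atTop (𝓝 0) := fun v => by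
    have h1 := ((ContinuousLinearMap.apply ℝ ℝ v).continuous.tendsto
      (0 : StrongDual ℝ X)).comp (he.comp hψt)
    rwa [map_zero] at h1
  -- The limit direction is polar to the tangent cone, hence a combination of gradients.
  obtain ⟨k, hk, y', hPk⟩ := SemiInfinite.exists_mem_hull_add_comp_of_forall_apply_nonpos
    (SemiInfinite.isCompact_activeGradients hg_cont hg'_cont xbar) hhd
    (Set.forall_mem_image.2 hgd) (p := P) fun w hhw hgw =>
      SemiInfinite.limit_proximalNormal_apply_nonpos
        (fun η hη => SemiInfinite.exists_near_direction_mem_feasibleSet hg_diff hg_cont hg'_cont hh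
          hsurj hx_feas hhw (Set.forall_mem_image.1 hgw) hη)
        hr (hx.comp hψt) (fun n => hxΩ (ψ n)) (fun n => hprox (ψ n)) (fun n => hκ (ψ n))
        (fun n => (hc0 (ψ n)).le) (fun n => hcp1 (ψ n)) hlimPv
  have hε : Tendsto (fun n : ℕ => 1 / ((n : ℝ) + 1)) atTop (𝓝 0) :=
    tendsto_one_div_add_atTop_nhds_zero_nat
  have hε0 : ∀ n : ℕ, 0 < 1 / ((n : ℝ) + 1) := fun n => Nat.one_div_pos_of_nat
  rcases hcP.1.1.eq_or_lt with hzero | hpos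
  · -- Unbounded multipliers produce a unit singular subgradient excluded by the qualification
    -- condition.
    exfalso
    have hsing : -P ∈ SemiInfinite.singularSubdifferential f xbar := by
      refine ⟨u ∘ ψ, c ∘ ψ, fun n => 1 / ((n : ℝ) + 1), fun n => -(p (ψ n) + e (ψ n)),
        hu.comp hψt, hfu.comp hψt, fun n => hc0 _, ?_, hε0, hε, fun n => hsub _ _ (hε0 n),
        fun v => ?_⟩
      · exact hzero ▸ hlimc
      · have h1 := ((hlimPv v).add (hlimc.mul (hlime v))).neg
        rw [mul_zero, add_zero] at h1
        refine h1.congr fun n => ?_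
        simp only [Function.comp_apply, neg_apply, add_apply]
        ring
    have hmem : -P ∈ -SemiInfinite.activeGradientCone g xbar -
        SemiInfinite.adjointRange h xbar := by
      refine Set.mem_sub.2 ⟨-k, Set.neg_mem_neg.2 hk, _, ⟨y', rfl⟩, ?_⟩
      rw [hPk]
      abel
    have hP0 : -P ∈ ({0} : Set (StrongDual ℝ X)) := hqual ▸ ⟨hsing, hmem⟩
    have hP0' : P = 0 := neg_eq_zero.1 hP0
    have h1 : Tendsto (fun n => c (ψ n) + ‖c (ψ n) • p (ψ n)‖) atTop (𝓝 (c₀ + ‖P‖)) :=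
      hlimc.add hlimP.norm
    have h2 : (fun n => c (ψ n) + ‖c (ψ n) • p (ψ n)‖) = fun _ => (1 : ℝ) := by
      funext n
      rw [hnorm, hcp]
    rw [h2, hP0', norm_zero, add_zero] at h1
    have h3 := tendsto_nhds_unique h1 tendsto_const_nhds
    simp only at hzero
    linarith
  · simp only at hpos
    obtain ⟨lam, hlam0, hlamA, hlam⟩ := SemiInfinite.exists_finsupp_of_mem_activeGradientCone
      (c := c₀⁻¹ • k) (PointedCone.smul_mem _ (inv_pos.2 hpos).le hk)
    refine ⟨lam, c₀⁻¹ • y', hlam0, hlamA, -(c₀⁻¹ • P), ?_, ?_⟩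
    · refine ⟨u ∘ ψ, fun n => 1 / ((n : ℝ) + 1), fun n => -(p (ψ n) + e (ψ n)),
        hu.comp hψt, hfu.comp hψt, hε0, hε, fun n => hsub _ _ (hε0 n), fun v => ?_⟩
      have h1 := (((hlimc.inv₀ hpos.ne').mul (hlimPv v)).add (hlime v)).neg
      rw [add_zero] at h1
      refine h1.congr fun n => ?_
      simp only [neg_apply, add_apply]
      rw [inv_mul_cancel_left₀ (hc0 (ψ n)).ne']
    · rw [hlam, hPk, ContinuousLinearMap.smul_comp, smul_add]
      abel
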